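/- **Setting.** Let $T>0$, $d\in\mathbb N$, and let $(\Omega,\mathcal F,\mathbb P)$ be a complete probability space with a filtration $\mathbb F=\{\mathcal F_t\}_{t\in[0,T]}$ such that every $\mathcal F_t$ contains all $\mathbb P$-null sets. For nonempty $A,B\subseteq\mathbb R^d$ let $h(A,B)\in[0,\infty]$ be the Hausdorff distance (Euclidean norm). A set-valued map $G$ is measurable with respect to a $\sigma$-algebra $\mathcal M$ if $\{x: G(x)\cap C\neq\emptyset\}\in\mathcal M$ for every closed $C\subseteq\mathbb R^d$. A process on $[0,T]\times\Omega$, with values in $\mathbb R^d$ or set-valued, is nonanticipative if it is $\mathscr B([0,T])\otimes\mathcal F$-measurable and its value at each time $t$ is $\mathcal F_t$-measurable. For a set-valued process $\Phi$, let $S^2_{\mathbb F}(\Phi)$ be the set of all nonanticipative $\varphi$ with $\mathbb E\int_0^T|\varphi_s|^2ds<\infty$ and $\varphi_s(\omega)\in\Phi_s(\omega)$ for $ds\otimes d\mathbb P$-a.e. $(s,\omega)$. Let $\mathscr A^2_{\mathbb F}(\mathscr G)$ be the class of nonanticipative set-valued processes $\Phi$ with nonempty closed convex (possibly unbounded) values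 in $\mathbb R^d$ such that $S^2_{\mathbb F}(\Phi)\neq\emptyset$. For $0\le t_0<t\le T$ put $J_{t_0,t}(\Phi)=\{\int_{t_0}^t\varphi_s\,ds:\varphi\in S^2_{\mathbb F}(\Phi)\}$. Let $\overline{\mathrm{dec}}_{\mathcal F_t}J_{t_0,t}(\Phi)$ be the closure in $\mathbb L^2(\Omega,\mathcal F_t,\mathbb P;\mathbb R^d)$ of the smallest set $V\supseteq J_{t_0,t}(\Phi)$ such that $\mathbf 1_Af+\mathbf 1_{A^c}g\in V$ whenever $f,g\in V$ and $A\in\mathcal F_t$. The set-valued Lebesgue integral $\int_{t_0}^t\Phi_s\,ds$ is the ($\mathbb P$-a.s. unique) $\mathcal F_t$-measurable map $I$ from $\Omega$ to the nonempty closed subsets of $\mathbb R^d$ whose set of $\mathcal F_t$-measurable square-integrable a.s. selectors is exactly $\overline{\mathrm{dec}}_{\mathcal F_t}J_{t_0,t}(\Phi)$. **Theorem.** Let $F,\tilde F\in\mathscr A^2_{\mathbb F}(\mathscr G)$ satisfy $\mathbb E\big[\int_0^Th^2(F_s,\tilde F_s)\,ds\big]<\infty$. Then for all $0\le t_0<t\le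 T$ the integrals $\int_{t_0}^tF_s\,ds$ and $\int_{t_0}^t\tilde F_s\,ds$ exist, and (for any versions of them) $$h^2\Big(\int_{t_0}^tF_s\,ds,\int_{t_0}^t\tilde F_s\,ds\Big)\le (t-t_0)\int_{t_0}^th^2(F_s,\tilde F_s)\,ds\qquad\mathbb P\text{-a.s.}$$ -/

import Mathlib

open MeasureTheory Set
open scoped ENNReal

namespace SetValued

/-! ### Measurable set-valued mappings and their selectors -/

section Selectors

variable {X E : Type*}

/-- A set-valued mapping is `m`-measurable if the preimage (in the hitting sense) of every closed
set is in `m`. -/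
def MeasurableMap [TopologicalSpace E] (m : MeasurableSpace X) (F : X → Set E) : Prop :=
  ∀ C : Set E, IsClosed C → MeasurableSet[m] {x | (F x ∩ C).Nonempty}

variable {mX : MeasurableSpace X} [NormedAddCommGroup E] [MeasurableSpace E]

/-- The set `S²(F)`, relative to a sub-σ-algebra `m`: all `m`-measurable, square integrable
almost-everywhere selectors of `F`. -/
def squareSelectors (μ : Measure X) (m : MeasurableSpace X) (F : X → Set E) : Set (X → E) :=
  {f | Measurable[m] f ∧ MemLp f 2 μ ∧ ∀ᵐ x ∂μ, f x ∈ F x}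

/-- `V` is `m`-decomposable: `1_A f + 1_{Aᶜ} g ∈ V` for all `f, g ∈ V` and all `A ∈ m`. -/
def IsDecomposable (m : MeasurableSpace X) (V : Set (X → E)) : Prop :=
  ∀ f ∈ V, ∀ g ∈ V, ∀ A : Set X, MeasurableSet[m] A → A.indicator f + Aᶜ.indicator g ∈ V

/-- The `m`-decomposable hull: the smallest `m`-decomposable set containing `V`.
(If `V` consists of `m`-measurable functions, so does its hull.) -/
def decomposableHull (m : MeasurableSpace X) (V : Set (X → E)) : Set (X → E) :=
  ⋂₀ {W | IsDecomposable m W ∧ V ⊆ W}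

/-- The closed `m`-decomposable hull: the closure of the `m`-decomposable hull in the space of
`m`-measurable square integrable functions, for convergence in `L²(μ)`. -/
def closedDecomposableHull (μ : Measure X) (m : MeasurableSpace X) (V : Set (X → E)) :
    Set (X → E) :=
  {f | Measurable[m] f ∧ MemLp f 2 μ ∧
    ∀ ε : ℝ≥0∞, 0 < ε → ∃ g ∈ decomposableHull m V, eLpNorm (f - g) 2 μ < ε}

end Selectors

/-! ### Nonanticipative set-valued processes on `[0, T]` and their Lebesgue integrals -/

section Processes

variable {Ω : Type*} {mΩ : MeasurableSpace Ω} {T : ℝ} {d : ℕ}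

/-- Lebesgue measure on the time interval `[0, T]`. -/
noncomputable def timeMeasure (T : ℝ) : Measure (Icc (0 : ℝ) T) :=
  Measure.comap (Subtype.val) volume

/-- A process is nonanticipative if it is jointly measurable and adapted. -/
def Nonanticipative (ℱ : Filtration (Icc (0 : ℝ) T) mΩ)
    (φ : Icc (0 : ℝ) T → Ω → EuclideanSpace ℝ (Fin d)) : Prop :=
  Measurable (fun p : Icc (0 : ℝ) T × Ω => φ p.1 p.2) ∧ ∀ s, Measurable[ℱ s] (φ s)

/-- A set-valued process is nonanticipative if it is jointly measurable and adapted. -/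
def NonanticipativeSet (ℱ : Filtration (Icc (0 : ℝ) T) mΩ)
    (Φ : Icc (0 : ℝ) T → Ω → Set (EuclideanSpace ℝ (Fin d))) : Prop :=
  MeasurableMap Prod.instMeasurableSpace (fun p : Icc (0 : ℝ) T × Ω => Φ p.1 p.2) ∧
    ∀ s, MeasurableMap (ℱ s) (Φ s)

/-- The set `S²_𝔽(Φ)`: all nonanticipative selectors of `Φ` (`dt ⊗ dℙ`-almost everywhere) that
are square integrable on `[0, T] × Ω`. -/
def nonanticipativeSelectors (P : Measure Ω) (ℱ : Filtration (Icc (0 : ℝ) T) mΩ)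
    (Φ : Icc (0 : ℝ) T → Ω → Set (EuclideanSpace ℝ (Fin d))) :
    Set (Icc (0 : ℝ) T → Ω → EuclideanSpace ℝ (Fin d)) :=
  {φ | Nonanticipative ℱ φ ∧
    MemLp (fun p : Icc (0 : ℝ) T × Ω => φ p.1 p.2) 2 ((timeMeasure T).prod P) ∧
    ∀ᵐ p ∂((timeMeasure T).prod P), φ p.1 p.2 ∈ Φ p.1 p.2}

/-- The class `𝒜²_𝔽([0, T] × Ω; 𝒢(ℝᵈ))`: nonanticipative set-valued processes with nonempty closed
convex values that have a square integrable nonanticipative selector. -/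
structure SquareIntegrableConvex (P : Measure Ω) (ℱ : Filtration (Icc (0 : ℝ) T) mΩ)
    (Φ : Icc (0 : ℝ) T → Ω → Set (EuclideanSpace ℝ (Fin d))) : Prop where
  nonempty : ∀ s ω, (Φ s ω).Nonempty
  isClosed : ∀ s ω, IsClosed (Φ s ω)
  convex : ∀ s ω, Convex ℝ (Φ s ω)
  nonanticipative : NonanticipativeSet ℱ Φ
  selectors_nonempty : (nonanticipativeSelectors P ℱ Φ).Nonempty

/-- The set `J_{t₀,t}(Φ)` of all random vectors `∫_{t₀}^t φ_s ds` with `φ ∈ S²_𝔽(Φ)`. -/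
def selectorIntegrals (P : Measure Ω) (ℱ : Filtration (Icc (0 : ℝ) T) mΩ)
    (Φ : Icc (0 : ℝ) T → Ω → Set (EuclideanSpace ℝ (Fin d))) (t₀ t : Icc (0 : ℝ) T) :
    Set (Ω → EuclideanSpace ℝ (Fin d)) :=
  (fun φ ω => ∫ s in Ioc t₀ t, φ s ω ∂(timeMeasure T)) '' nonanticipativeSelectors P ℱ Φ

/-- `I` is (a version of) the set-valued Lebesgue integral `∫_{t₀}^t Φ_s ds`: an `ℱ_t`-measurable
set-valued random variable with nonempty closed values, whose square integrable `ℱ_t`-measurable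
selectors are exactly the closed `ℱ_t`-decomposable hull of `J_{t₀,t}(Φ)`. -/
structure IsLebesgueIntegral (P : Measure Ω) (ℱ : Filtration (Icc (0 : ℝ) T) mΩ)
    (Φ : Icc (0 : ℝ) T → Ω → Set (EuclideanSpace ℝ (Fin d))) (t₀ t : Icc (0 : ℝ) T)
    (I : Ω → Set (EuclideanSpace ℝ (Fin d))) : Prop where
  nonempty : ∀ ω, (I ω).Nonempty
  isClosed : ∀ ω, IsClosed (I ω)
  measurable : MeasurableMap (ℱ t) I
  selectors_eq : squareSelectors P (ℱ t) I =
    closedDecomposableHull P (ℱ t) (selectorIntegrals P ℱ Φ t₀ t)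

end Processes

end SetValued

/-! Existence. The closed decomposable hull of the selector integrals is a closed decomposable
subset of L² over `ℱ t`, and every nonempty set of this kind consists of the selectors of a
measurable closed-valued map (`IsClosedSquareIntegrable.exists_squareSelectors_eq`). The integrals
must first be shown `ℱ t`-measurable although the processes are only adapted and jointly measurable.
An orthogonality argument with the conditional expectation does this up to a null set
(`aestronglyMeasurable_integral_left`), and `ℱ t` contains the null sets.

Inequality. By symmetry it suffices to bound the distance from points of `I` to `I'`. For a selector
φ of `F`, selectors gₙ of `F'` can be glued together so that |φ - gₙ| decreases pointwise to at most
dist(φ, F') ≤ h(F, F'). Each ∫gₙ lies in `I'` a.s., so monotone convergence gives dist(∫φ, I') ≤ ∫h,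
and Cauchy–Schwarz yields the factor t - t₀. This bound is pointwise in ω, so it survives gluing
along events and L² limits, hence holds for all square integrable selectors of `I`. A Castaing
representation of `I`, truncated to be square integrable, carries it to all points of `I`. -/

namespace SetValued

open Filter Topology

/-! ### Measurable selectors and Castaing representations -/

section Castaing

variable {X E : Type*} [NormedAddCommGroup E] [ProperSpace E] [MeasurableSpace E] [BorelSpace E]

-- In a proper space the distance to a closed set is attained, so it is at most `r` exactly when the
-- set hits the closed ball of radius `r`.
omit [MeasurableSpace E] [BorelSpace E] in
theorem MeasurableMap.measurable_infDist {m : MeasurableSpace X} {G : X → Set E}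
    (hG : MeasurableMap m G) (hne : ∀ x, (G x).Nonempty) (hcl : ∀ x, IsClosed (G x)) (y : E) :
    Measurable fun x => Metric.infDist y (G x) := by
  refine measurable_of_Iic fun r => ?_
  convert hG (Metric.closedBall y r) Metric.isClosed_closedBall using 1
  ext x
  constructor
  · intro hx
    obtain ⟨z, hz, h⟩ := (hcl x).exists_infDist_eq_dist (hne x) y
    refine ⟨z, hz, ?_⟩
    rw [Metric.mem_closedBall, dist_comm, ← h]
    exact hx
  · rintro ⟨z, hz, hzr⟩
    rw [Metric.mem_closedBall, dist_comm] at hzr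
    exact (Metric.infDist_le_dist_of_mem hz).trans hzr

/-- An approximate measurable selector can be improved by moving it only a little. -/
theorem MeasurableMap.exists_improved_selector {m : MeasurableSpace X} {G : X → Set E}
    (hG : MeasurableMap m G) (hne : ∀ x, (G x).Nonempty) (hcl : ∀ x, IsClosed (G x))
    {u : X → E} (hu : Measurable u) {r s : ℝ} (hs : 0 < s)
    (hur : ∀ x, Metric.infDist (u x) (G x) < r) :
    ∃ v : X → E, Measurable v ∧ ∀ x, Metric.infDist (v x) (G x) < s ∧ dist (u x) (v x) < r := by
  classical
  have h : ∀ x, ∃ n, Metric.infDist (TopologicalSpace.denseSeq E n) (G x) < s ∧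
      dist (u x) (TopologicalSpace.denseSeq E n) < r := by
    intro x
    obtain ⟨y, hy, hyr⟩ := (Metric.infDist_lt_iff (hne x)).1 (hur x)
    have hopen : IsOpen {z : E | Metric.infDist z (G x) < s ∧ dist (u x) z < r} :=
      (isOpen_lt (Metric.continuous_infDist_pt _) continuous_const).inter
        (isOpen_lt (continuous_const.dist continuous_id) continuous_const)
    obtain ⟨n, hn⟩ := (TopologicalSpace.denseRange_denseSeq E).exists_mem_open hopen
      ⟨y, by rwa [Metric.infDist_zero_of_mem hy], hyr⟩
    exact ⟨n, hn⟩
  -- Taking the first admissible index makes the choice measurable.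
  refine ⟨fun x => TopologicalSpace.denseSeq E (Nat.find (h x)), ?_, fun x => Nat.find_spec (h x)⟩
  refine Measurable.find (f := fun n _ => TopologicalSpace.denseSeq E n)
    (fun n => measurable_const) (fun n => ?_) h
  exact (measurableSet_lt (hG.measurable_infDist hne hcl _) measurable_const).inter
    (measurableSet_lt (hu.dist measurable_const) measurable_const)

/-- Near every approximate measurable selector there is a measurable selector. -/
theorem MeasurableMap.exists_selector_near {m : MeasurableSpace X} {G : X → Set E}
    (hG : MeasurableMap m G) (hne : ∀ x, (G x).Nonempty) (hcl : ∀ x, IsClosed (G x))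
    {u : X → E} (hu : Measurable u) {r : ℝ} (hr : 0 < r)
    (hur : ∀ x, Metric.infDist (u x) (G x) < r) :
    ∃ v : X → E, Measurable v ∧ ∀ x, v x ∈ G x ∧ dist (u x) (v x) ≤ 2 * r := by
  -- The k-th tolerance is r/2ᵏ. It also bounds the k-th move, so the moves add up to at most 2r.
  have hpos : ∀ k : ℕ, 0 < r / 2 / 2 ^ k * 2 := fun k => by positivity
  choose! next hnm hn using fun (k : ℕ) (u : X → E)
    (h : Measurable u ∧ ∀ x, Metric.infDist (u x) (G x) < r / 2 / 2 ^ k * 2) =>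
      hG.exists_improved_selector hne hcl h.1 (hpos (k + 1)) h.2
  let w : ℕ → X → E := fun k => Nat.rec u (fun k v => next k v) k
  have hw : ∀ k, Measurable (w k) ∧ ∀ x, Metric.infDist (w k x) (G x) < r / 2 / 2 ^ k * 2 := by
    intro k
    induction k with
    | zero => exact ⟨hu, fun x => by
      have := hur x
      change Metric.infDist (u x) (G x) < _
      simpa using this⟩
    | succ k ih => exact ⟨hnm k _ ih, fun x => (hn k _ ih x).1⟩
  have hd : ∀ x k, dist (w k x) (w (k + 1) x) ≤ 2 * r / 2 / 2 ^ k := by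
    intro x k
    have := (hn k _ (hw k) x).2.le
    calc _ ≤ _ := this
      _ = _ := by ring
  have hlim : ∀ x, ∃ y, Tendsto (fun k => w k x) atTop (𝓝 y) := fun x =>
    cauchySeq_tendsto_of_complete (cauchySeq_of_le_geometric_two (hd x))
  choose v hv using hlim
  refine ⟨v, measurable_of_tendsto_metrizable (fun k => (hw k).1) (tendsto_pi_nhds.2 hv),
    fun x => ⟨?_, dist_le_of_le_geometric_two_of_tendsto₀ (hd x) (hv x)⟩⟩
  rw [(hcl x).mem_iff_infDist_zero (hne x)]
  refine tendsto_nhds_unique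
    (((Metric.continuous_infDist_pt (G x)).tendsto (v x)).comp (hv x)) ?_
  refine squeeze_zero (fun _ => Metric.infDist_nonneg) (fun k => ((hw k).2 x).le) ?_
  have := (tendsto_pow_atTop_nhds_zero_of_lt_one (r := (1 / 2 : ℝ)) (by norm_num)
    (by norm_num)).const_mul r
  rw [mul_zero] at this
  refine this.congr fun k => ?_
  rw [one_div, inv_pow]
  ring

/-- **Castaing representation**: a measurable map with nonempty closed values is the closure of
countably many measurable selectors. -/
theorem MeasurableMap.exists_castaing {m : MeasurableSpace X} {G : X → Set E}
    (hG : MeasurableMap m G) (hne : ∀ x, (G x).Nonempty) (hcl : ∀ x, IsClosed (G x)) :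
    ∃ g : ℕ → X → E, (∀ n, Measurable (g n)) ∧ (∀ n x, g n x ∈ G x) ∧
      ∀ x, G x ⊆ closure (range fun n => g n x) := by
  classical
  have hr : ∀ k : ℕ, (0 : ℝ) < 1 / (k + 1) := fun k => Nat.one_div_pos_of_nat
  have hu : ∀ p : ℕ × ℕ, ∃ u : X → E, Measurable u ∧
      (∀ x, Metric.infDist (u x) (G x) < 1 / (p.2 + 1)) ∧
      ∀ x, Metric.infDist (TopologicalSpace.denseSeq E p.1) (G x) < 1 / (p.2 + 1) →
        u x = TopologicalSpace.denseSeq E p.1 := by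
    rintro ⟨n, k⟩
    have h : ∀ x, ∃ j, Metric.infDist (TopologicalSpace.denseSeq E j) (G x) < 1 / ((k : ℝ) + 1) := by
      intro x
      obtain ⟨y, hy⟩ := hne x
      obtain ⟨j, hj⟩ := (TopologicalSpace.denseRange_denseSeq E).exists_mem_open
        (isOpen_lt (Metric.continuous_infDist_pt (G x)) (continuous_const (y := 1 / ((k : ℝ) + 1))))
        ⟨y, by simpa [Metric.infDist_zero_of_mem hy] using Nat.cast_add_one_pos (α := ℝ) k⟩
      exact ⟨j, hj⟩
    have hms : ∀ j, MeasurableSet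
        {x | Metric.infDist (TopologicalSpace.denseSeq E j) (G x) < 1 / ((k : ℝ) + 1)} := fun j =>
      measurableSet_lt (hG.measurable_infDist hne hcl _) measurable_const
    refine ⟨fun x => if Metric.infDist (TopologicalSpace.denseSeq E n) (G x) < 1 / ((k : ℝ) + 1)
      then TopologicalSpace.denseSeq E n else TopologicalSpace.denseSeq E (Nat.find (h x)),
      Measurable.ite (hms n) measurable_const
        (Measurable.find (f := fun n _ => TopologicalSpace.denseSeq E n)
          (fun n => measurable_const) hms h), fun x => ?_, fun x hx => if_pos hx⟩
    dsimp only
    split_ifs with hx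
    · exact hx
    · exact Nat.find_spec (h x)
  choose u hum hud hun using hu
  choose v hvm hv using fun p => hG.exists_selector_near hne hcl (hum p) (hr p.2) (hud p)
  refine ⟨fun i => v i.unpair, fun i => hvm _, fun i x => (hv _ x).1, fun x y hy => ?_⟩
  rw [Metric.mem_closure_range_iff]
  intro ε hε
  -- A dense point lies within 1/(k+1) of `y`, and the selector lies within 2/(k+1) of that point;
  -- hence ε/3.
  obtain ⟨k, hk⟩ := exists_nat_one_div_lt (show (0 : ℝ) < ε / 3 by positivity)
  obtain ⟨n, hn⟩ := (TopologicalSpace.denseRange_denseSeq E).exists_dist_lt y (hr k)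
  refine ⟨Nat.pair n k, ?_⟩
  change dist y (v (Nat.unpair (Nat.pair n k)) x) < ε
  rw [Nat.unpair_pair]
  have h1 := hun (n, k) x
    ((Metric.infDist_le_dist_of_mem hy).trans_lt (by rwa [dist_comm] at hn))
  have h2 := (hv (n, k) x).2
  rw [h1] at h2
  have h3 := dist_triangle y (TopologicalSpace.denseSeq E n) (v (n, k) x)
  dsimp only at h2
  linarith

end Castaing

/-! ### Decomposable sets and gluing -/

section Combinations

variable {X E : Type*} {m : MeasurableSpace X} [NormedAddCommGroup E]

theorem subset_decomposableHull (V : Set (X → E)) : V ⊆ decomposableHull m V :=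
  subset_sInter fun _ hW => hW.2

theorem decomposableHull_subset {V W : Set (X → E)} (hW : IsDecomposable m W) (h : V ⊆ W) :
    decomposableHull m V ⊆ W :=
  sInter_subset_of_mem ⟨hW, h⟩

theorem isDecomposable_decomposableHull (V : Set (X → E)) :
    IsDecomposable m (decomposableHull m V) := fun f hf g hg A hA W hW =>
  hW.1 f (hf W hW) g (hg W hW) A hA

theorem indicator_add_indicator_compl_apply (f g : X → E) (A : Set X) [DecidablePred (· ∈ A)]
    (x : X) : (A.indicator f + Aᶜ.indicator g) x = if x ∈ A then f x else g x := by
  by_cases hx : x ∈ A <;> simp [hx]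

variable [SecondCountableTopology E] [MeasurableSpace E] [BorelSpace E]

/-- Pointwise best approximation of `φ` by members of a sequence stays in a decomposable set. -/
theorem exists_antitone_edist {W : Set (X → E)} (hW : IsDecomposable m W)
    (hWm : ∀ f ∈ W, Measurable f) {φ : X → E} (hφ : Measurable φ) {f : ℕ → X → E}
    (hf : ∀ n, f n ∈ W) :
    ∃ g : ℕ → X → E, (∀ n, g n ∈ W) ∧ (∀ x, Antitone fun n => edist (φ x) (g n x)) ∧
      g 0 = f 0 ∧ ∀ n x, edist (φ x) (g n x) ≤ edist (φ x) (f n x) := by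
  classical
  let better : (X → E) → (X → E) → Set X := fun a b => {x | edist (φ x) (a x) < edist (φ x) (b x)}
  let g : ℕ → X → E := fun n => Nat.rec (f 0) (fun n v =>
    (better (f (n + 1)) v).indicator (f (n + 1)) + (better (f (n + 1)) v)ᶜ.indicator v) n
  have hg : ∀ n, g n ∈ W := by
    intro n
    induction n with
    | zero => exact hf 0
    | succ n ih =>
      exact hW _ (hf _) _ ih _ (measurableSet_lt (hφ.edist (hWm _ (hf _)))
        (hφ.edist (hWm _ ih)))
  have hstep : ∀ n x, edist (φ x) (g (n + 1) x) =
      min (edist (φ x) (f (n + 1) x)) (edist (φ x) (g n x)) := by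
    intro n x
    have : g (n + 1) x = if x ∈ better (f (n + 1)) (g n) then f (n + 1) x else g n x :=
      indicator_add_indicator_compl_apply _ _ _ x
    rw [this]
    split_ifs with h
    · exact (min_eq_left (le_of_lt h)).symm
    · exact (min_eq_right (not_lt.1 h)).symm
  refine ⟨g, hg, fun x => antitone_nat_of_succ_le fun n => ?_, rfl, fun n x => ?_⟩
  · rw [hstep]
    exact min_le_right _ _
  · cases n with
    | zero => exact le_rfl
    | succ n =>
      rw [hstep]
      exact min_le_left _ _

omit [SecondCountableTopology E] [MeasurableSpace E] [BorelSpace E] in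
theorem iInf_edist_le_infEDist {f : ℕ → E} {y : E} {S : Set E} (hS : S ⊆ closure (range f)) :
    ⨅ n, edist y (f n) ≤ Metric.infEDist y S := by
  calc ⨅ n, edist y (f n) = Metric.infEDist y (range f) := by
        rw [Metric.infEDist, iInf_range]
    _ = Metric.infEDist y (closure (range f)) := Metric.infEDist_closure.symm
    _ ≤ Metric.infEDist y S := Metric.infEDist_anti hS

end Combinations

/-! ### Closed decomposable sets as sets of selectors -/

section Representation

variable {X E : Type*} [NormedAddCommGroup E]

theorem eLpNorm_two_pow_two {mX : MeasurableSpace X} (μ : Measure X) (f : X → E) :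
    eLpNorm f 2 μ ^ 2 = ∫⁻ x, ‖f x‖ₑ ^ 2 ∂μ := by
  have h := eLpNorm_nnreal_pow_eq_lintegral (f := f) (μ := μ) (p := 2) two_ne_zero
  simpa using h

theorem MemLp.lintegral_edist_sq_lt_top {mX : MeasurableSpace X} {μ : Measure X} {f g : X → E}
    (hf : MemLp f 2 μ) (hg : MemLp g 2 μ) : ∫⁻ x, edist (f x) (g x) ^ 2 ∂μ < ∞ := by
  have h := eLpNorm_two_pow_two μ (f - g)
  simp only [Pi.sub_apply, ← edist_eq_enorm_sub] at h
  rw [← h]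
  exact ENNReal.pow_lt_top (hf.sub hg).eLpNorm_lt_top

variable [MeasurableSpace E] [BorelSpace E]

/-- The closure of the values of a sequence of measurable functions is measurable. -/
theorem measurableMap_closure_range [ProperSpace E] {m : MeasurableSpace X} {f : ℕ → X → E}
    (hf : ∀ n, Measurable (f n)) : MeasurableMap m fun x => closure (range fun n => f n x) := by
  intro C hC
  have hCk : ∀ k : ℕ, IsCompact (Metric.closedBall (0 : E) k ∩ C) := fun k =>
    (isCompact_closedBall 0 (k : ℝ)).inter_right hC
  -- Cutting `C` down to a compact piece matters: disjoint compact and closed sets have positive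
  -- distance, so approaching the piece arbitrarily closely forces an intersection.
  have key : {x | (closure (range fun n => f n x) ∩ C).Nonempty} =
      ⋃ k : ℕ, ⋂ j : ℕ, ⋃ n : ℕ,
        {x | Metric.infEDist (f n x) (Metric.closedBall (0 : E) k ∩ C) < (j : ℝ≥0∞)⁻¹} := by
    ext x
    simp only [mem_ofPred_eq, mem_iUnion, mem_iInter]
    constructor
    · rintro ⟨y, hy, hyC⟩
      obtain ⟨k, hk⟩ := exists_nat_ge ‖y‖
      refine ⟨k, fun j => ?_⟩
      obtain ⟨_, ⟨n, rfl⟩, hn⟩ := EMetric.mem_closure_iff.1 hy (j : ℝ≥0∞)⁻¹ (by simp)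
      refine ⟨n, lt_of_le_of_lt (Metric.infEDist_le_edist_of_mem (y := y) ⟨by simpa using hk, hyC⟩) ?_⟩
      rwa [edist_comm]
    · rintro ⟨k, hk⟩
      by_contra hemp
      have hdisj : Disjoint (Metric.closedBall (0 : E) k ∩ C) (closure (range fun n => f n x)) := by
        rw [Set.disjoint_left]
        exact fun y hy hy' => hemp ⟨y, hy', hy.2⟩
      obtain ⟨r, hr, hlt⟩ := Metric.exists_pos_forall_lt_edist (hCk k) isClosed_closure hdisj
      obtain ⟨j, hj⟩ := ENNReal.exists_inv_nat_lt (a := (r : ℝ≥0∞)) (by exact_mod_cast hr.ne')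
      obtain ⟨n, hn⟩ := hk j
      refine absurd (hn.trans hj) (not_lt.2 (Metric.le_infEDist.2 fun y hy => ?_))
      rw [edist_comm]
      exact (hlt y hy _ (subset_closure (mem_range_self n))).le
  rw [key]
  refine MeasurableSet.iUnion fun k => MeasurableSet.iInter fun j => MeasurableSet.iUnion fun n => ?_
  exact measurableSet_lt ((hf n).infEDist) measurable_const

variable {m mX : MeasurableSpace X} {μ : Measure X} {K : Set (X → E)}

/-- `K` is a closed subset of the `m`-measurable functions of `L²(μ)`. -/
structure IsClosedSquareIntegrable (μ : Measure X) (m : MeasurableSpace X) (K : Set (X → E)) :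
    Prop where
  measurable : ∀ f ∈ K, Measurable[m] f
  memLp : ∀ f ∈ K, MemLp f 2 μ
  mem_of_approx : ∀ f, Measurable[m] f → MemLp f 2 μ →
    (∀ ε : ℝ≥0∞, 0 < ε → ∃ g ∈ K, eLpNorm (f - g) 2 μ < ε) → f ∈ K

/-- Gluing the `f n` according to which is nearest to `φ` stays in `K`. The distances decrease to
zero a.e. and are dominated by the first one, so the glued functions converge to `φ` in L². -/
theorem IsClosedSquareIntegrable.mem_of_ae_mem_closure [SecondCountableTopology E] (hm : m ≤ mX)
    (hK : IsClosedSquareIntegrable μ m K) (hdec : IsDecomposable m K) {φ : X → E}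
    (hφ : Measurable[m] φ) (hφL : MemLp φ 2 μ) {f : ℕ → X → E} (hf : ∀ n, f n ∈ K)
    (hcl : ∀ᵐ x ∂μ, φ x ∈ closure (range fun n => f n x)) : φ ∈ K := by
  obtain ⟨g, hg, hanti, -, hgf⟩ := exists_antitone_edist hdec hK.measurable hφ hf
  have hmeas : ∀ n, Measurable fun x => edist (φ x) (g n x) ^ 2 := fun n =>
    ((hφ.mono hm le_rfl).edist ((hK.measurable _ (hg n)).mono hm le_rfl)).pow_const 2
  have hlim : Tendsto (fun n => ∫⁻ x, edist (φ x) (g n x) ^ 2 ∂μ) atTop (𝓝 0) := by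
    rw [← lintegral_zero (μ := μ)]
    refine tendsto_lintegral_of_dominated_convergence (fun x => edist (φ x) (g 0 x) ^ 2) hmeas
      (fun n => ae_of_all _ fun x => pow_le_pow_left' (hanti x (Nat.zero_le n)) 2)
      (MemLp.lintegral_edist_sq_lt_top hφL (hK.memLp _ (hg 0))).ne ?_
    filter_upwards [hcl] with x hx
    have h0 : ⨅ n, edist (φ x) (g n x) = 0 := by
      refine le_antisymm ((iInf_mono fun n => hgf n x).trans ?_) zero_le
      refine (iInf_edist_le_infEDist (S := {φ x}) (by simpa using hx)).trans ?_
      simp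
    have h1 := tendsto_atTop_iInf (hanti x)
    rw [h0] at h1
    simpa using ENNReal.Tendsto.pow (n := 2) h1
  refine hK.mem_of_approx φ hφ hφL fun ε hε => ?_
  obtain ⟨n, hn⟩ := (hlim.eventually (gt_mem_nhds (show 0 < ε ^ 2 by positivity))).exists
  refine ⟨g n, hg n, lt_of_pow_lt_pow_left' 2 ?_⟩
  rw [eLpNorm_two_pow_two]
  simpa only [Pi.sub_apply, ← edist_eq_enorm_sub] using hn

omit [MeasurableSpace E] [BorelSpace E] in
/-- The squared `L²`-distance of a function to a constant. -/
noncomputable def sqDistConst (μ : Measure X) (c : E) (h : X → E) : ℝ≥0∞ :=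
  ∫⁻ x, edist (h x) c ^ 2 ∂μ

omit mX in
theorem measurableSet_edist_lt [SecondCountableTopology E] {f g : X → E}
    (hf : Measurable[m] f) (hg : Measurable[m] g) (c : E) :
    MeasurableSet[m] {x | edist (f x) c < edist (g x) c} :=
  measurableSet_lt (hf.edist measurable_const) (hg.edist measurable_const)

-- Exchange argument: if `f` is within `b` of the minimum `a` and `h` is a competitor closer to `c`,
-- the gain from `f` to `h` is at most `b`. Finiteness of `a` allows the cancellation.
omit m [MeasurableSpace E] [BorelSpace E] in
theorem lintegral_tsub_sqDistConst_le {φ f h : X → E} {c : E} {a b : ℝ≥0∞} (ha : a ≠ ∞)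
    (hmeas : Measurable fun x => edist (h x) c ^ 2)
    (hval : ∀ x, edist (f x) c ^ 2 = (edist (f x) c ^ 2 - edist (φ x) c ^ 2) + edist (h x) c ^ 2)
    (hf : sqDistConst μ c f ≤ a + b) (hh : a ≤ sqDistConst μ c h) :
    ∫⁻ x, (edist (f x) c ^ 2 - edist (φ x) c ^ 2) ∂μ ≤ b := by
  have h2 : sqDistConst μ c f =
      ∫⁻ x, (edist (f x) c ^ 2 - edist (φ x) c ^ 2) ∂μ + sqDistConst μ c h := by
    rw [sqDistConst, sqDistConst, ← lintegral_add_right _ hmeas]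
    exact lintegral_congr hval
  rw [h2, add_comm] at hf
  have h3 := (add_le_add_left hh _).trans hf
  exact (ENNReal.add_le_add_iff_left ha).1 h3

/-- Up to null sets, members of a decomposable set stay as far from `c` as a minimizing sequence
for the squared `L²`-distance to `c`. -/
theorem IsDecomposable.ae_iInf_edist_le [SecondCountableTopology E] (hm : m ≤ mX)
    (hdec : IsDecomposable m K) (hmeas : ∀ f ∈ K, Measurable[m] f) {c : E} {f : ℕ → X → E}
    (hf : ∀ n, f n ∈ K)
    (hfin : ⨅ h ∈ K, sqDistConst μ c h ≠ ∞)
    (hmin : ∀ n : ℕ, sqDistConst μ c (f n) ≤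
      (⨅ h ∈ K, sqDistConst μ c h) + (n : ℝ≥0∞)⁻¹)
    {φ : X → E} (hφ : φ ∈ K) :
    ∀ᵐ x ∂μ, ⨅ n, edist (f n x) c ≤ edist (φ x) c := by
  classical
  have hsq : ∀ h ∈ K, Measurable[mX] fun x => edist (h x) c ^ 2 := fun h hh =>
    (((hmeas h hh).mono hm le_rfl).edist measurable_const).pow_const 2
  have hgap : ∀ n : ℕ, ∫⁻ x, (edist (f n x) c ^ 2 - edist (φ x) c ^ 2) ∂μ ≤ (n : ℝ≥0∞)⁻¹ := by
    intro n
    -- The competitor replaces `f n` by `φ` wherever `φ` is closer to `c`.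
    set A : Set X := {x | edist (φ x) c < edist (f n x) c} with hA
    have hAm : MeasurableSet[m] A := measurableSet_edist_lt (hmeas _ hφ) (hmeas _ (hf n)) c
    have hmem := hdec φ hφ (f n) (hf n) A hAm
    refine lintegral_tsub_sqDistConst_le hfin (hsq _ hmem) (fun x => ?_) (hmin n)
      (biInf_le (fun h => sqDistConst μ c h) hmem)
    rw [indicator_add_indicator_compl_apply]
    split_ifs with hx
    · exact (tsub_add_cancel_of_le (pow_le_pow_left' (le_of_lt hx) 2)).symm
    · rw [tsub_eq_zero_of_le (pow_le_pow_left' (not_lt.1 hx) 2), zero_add]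
  have hzero : ∫⁻ x, ((⨅ n, edist (f n x) c) ^ 2 - edist (φ x) c ^ 2) ∂μ = 0 := by
    refine le_antisymm (ENNReal.le_of_forall_pos_le_add fun ε hε _ => ?_) zero_le
    obtain ⟨n, hn⟩ := ENNReal.exists_inv_nat_lt (a := (ε : ℝ≥0∞)) (by exact_mod_cast hε.ne')
    rw [zero_add]
    refine (lintegral_mono fun x => ?_).trans ((hgap n).trans hn.le)
    exact tsub_le_tsub_right (pow_le_pow_left' (iInf_le _ n) 2) _
  have hmz : Measurable[mX] fun x => (⨅ n, edist (f n x) c) ^ 2 - edist (φ x) c ^ 2 :=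
    ((Measurable.iInf fun n => ((hmeas _ (hf n)).mono hm le_rfl).edist measurable_const).pow_const
      2).sub (hsq _ hφ)
  filter_upwards [(lintegral_eq_zero_iff hmz).1 hzero] with x hx
  exact (ENNReal.pow_le_pow_left_iff two_ne_zero).1 (tsub_eq_zero_iff_le.1 hx)

/-- **Hiai–Umegaki**: a nonempty closed decomposable set of square integrable functions is the set
of square integrable selectors of a measurable map with closed values. -/
theorem IsClosedSquareIntegrable.exists_squareSelectors_eq [ProperSpace E] [IsFiniteMeasure μ]
    (hm : m ≤ mX) (hK : IsClosedSquareIntegrable μ m K) (hdec : IsDecomposable m K)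
    (hne : K.Nonempty) :
    ∃ I : X → Set E, (∀ x, (I x).Nonempty) ∧ (∀ x, IsClosed (I x)) ∧ MeasurableMap m I ∧
      squareSelectors μ m I = K := by
  -- Constants are square integrable because the measure is finite.
  have hfin : ∀ c : E, ⨅ h ∈ K, sqDistConst μ c h ≠ ∞ := by
    intro c
    obtain ⟨f, hf⟩ := hne
    refine ne_top_of_le_ne_top ?_ (biInf_le (fun h => sqDistConst μ c h) hf)
    exact (MemLp.lintegral_edist_sq_lt_top (hK.memLp f hf) (memLp_const c)).ne
  have hex : ∀ i j : ℕ, ∃ f ∈ K, sqDistConst μ (TopologicalSpace.denseSeq E i) f ≤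
      (⨅ h ∈ K, sqDistConst μ (TopologicalSpace.denseSeq E i) h) + (j : ℝ≥0∞)⁻¹ := by
    intro i j
    have hlt := ENNReal.lt_add_right (hfin (TopologicalSpace.denseSeq E i))
      (b := (j : ℝ≥0∞)⁻¹) (by simp)
    obtain ⟨f, hf, hlt⟩ := by simpa only [iInf_lt_iff, exists_prop] using hlt
    exact ⟨f, hf, hlt.le⟩
  choose f hf hmin using hex
  have hall : ∀ φ ∈ K, ∀ᵐ x ∂μ, ∀ i, ⨅ j, edist (f i j x) (TopologicalSpace.denseSeq E i) ≤
      edist (φ x) (TopologicalSpace.denseSeq E i) := by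
    intro φ hφ
    rw [ae_all_iff]
    exact fun i => hdec.ae_iInf_edist_le hm hK.measurable (hf i) (hfin _) (hmin i) hφ
  have hfu : ∀ n : ℕ, f n.unpair.1 n.unpair.2 ∈ K := fun n => hf _ _
  refine ⟨fun x => closure (range fun n : ℕ => f n.unpair.1 n.unpair.2 x),
    fun x => (range_nonempty _).closure, fun x => isClosed_closure,
    measurableMap_closure_range fun n => hK.measurable _ (hfu n), ?_⟩
  refine Subset.antisymm
    (fun φ hφ => hK.mem_of_ae_mem_closure hm hdec hφ.1 hφ.2.1 hfu hφ.2.2) fun φ hφ =>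
    ⟨hK.measurable φ hφ, hK.memLp φ hφ, ?_⟩
  -- Near `φ x` there is a dense point, and a minimizing sequence for that point comes at least as
  -- close to it as `φ x`. The triangle inequality then puts `φ x` in the closure.
  filter_upwards [hall φ hφ] with x hx
  rw [EMetric.mem_closure_iff]
  intro ε hε
  obtain ⟨_, ⟨i, rfl⟩, hi⟩ := EMetric.mem_closure_iff.1
    ((TopologicalSpace.denseRange_denseSeq E) (φ x)) (ε / 2) (ENNReal.half_pos hε.ne')
  obtain ⟨j, hj⟩ := iInf_lt_iff.1 ((hx i).trans_lt hi)
  have hmem : f i j x ∈ range fun n : ℕ => f n.unpair.1 n.unpair.2 x :=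
    ⟨Nat.pair i j, by simp only [Nat.unpair_pair]⟩
  refine ⟨f i j x, hmem, ?_⟩
  refine (edist_triangle_right _ _ (TopologicalSpace.denseSeq E i)).trans_lt ?_
  calc _ < ε / 2 + ε / 2 := ENNReal.add_lt_add hi hj
    _ = ε := ENNReal.add_halves ε

theorem decomposableHull_memLp [SecondCountableTopology E] (hm : m ≤ mX) {V : Set (X → E)}
    (hV : ∀ f ∈ V, Measurable[m] f ∧ MemLp f 2 μ) :
    ∀ f ∈ decomposableHull m V, Measurable[m] f ∧ MemLp f 2 μ := by
  refine decomposableHull_subset (W := {f | Measurable[m] f ∧ MemLp f 2 μ}) ?_ hV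
  rintro f ⟨hfm, hf⟩ g ⟨hgm, hg⟩ A hA
  exact ⟨(hfm.indicator hA).add (hgm.indicator hA.compl),
    (hf.indicator (hm _ hA)).add (hg.indicator (hm _ hA).compl)⟩

theorem decomposableHull_subset_closedDecomposableHull [SecondCountableTopology E] (hm : m ≤ mX)
    {V : Set (X → E)} (hV : ∀ f ∈ V, Measurable[m] f ∧ MemLp f 2 μ) :
    decomposableHull m V ⊆ closedDecomposableHull μ m V := fun f hf =>
  ⟨(decomposableHull_memLp hm hV f hf).1, (decomposableHull_memLp hm hV f hf).2,
    fun ε hε => ⟨f, hf, by simpa using hε⟩⟩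

theorem isDecomposable_closedDecomposableHull [SecondCountableTopology E] (hm : m ≤ mX)
    {V : Set (X → E)} (hV : ∀ f ∈ V, Measurable[m] f ∧ MemLp f 2 μ) :
    IsDecomposable m (closedDecomposableHull μ m V) := by
  rintro f ⟨hfm, hfL, hf⟩ g ⟨hgm, hgL, hg⟩ A hA
  refine ⟨(hfm.indicator hA).add (hgm.indicator hA.compl),
    (hfL.indicator (hm _ hA)).add (hgL.indicator (hm _ hA).compl), fun ε hε => ?_⟩
  obtain ⟨f', hf', hfε⟩ := hf (ε / 2) (ENNReal.half_pos hε.ne')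
  obtain ⟨g', hg', hgε⟩ := hg (ε / 2) (ENNReal.half_pos hε.ne')
  refine ⟨_, isDecomposable_decomposableHull V f' hf' g' hg' A hA, ?_⟩
  have heq : A.indicator f + Aᶜ.indicator g - (A.indicator f' + Aᶜ.indicator g') =
      A.indicator (f - f') + Aᶜ.indicator (g - g') := by
    rw [indicator_sub', indicator_sub']
    abel
  rw [heq]
  have h1 := (hfL.sub (decomposableHull_memLp hm hV f' hf').2).indicator (hm _ hA)
  have h2 := (hgL.sub (decomposableHull_memLp hm hV g' hg').2).indicator (hm _ hA).compl
  calc _ ≤ eLpNorm (A.indicator (f - f')) 2 μ + eLpNorm (Aᶜ.indicator (g - g')) 2 μ :=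
        eLpNorm_add_le h1.1 h2.1 one_le_two
    _ ≤ eLpNorm (f - f') 2 μ + eLpNorm (g - g') 2 μ :=
        add_le_add (eLpNorm_indicator_le _) (eLpNorm_indicator_le _)
    _ < ε / 2 + ε / 2 := ENNReal.add_lt_add hfε hgε
    _ = ε := ENNReal.add_halves ε

theorem isClosedSquareIntegrable_closedDecomposableHull [SecondCountableTopology E] (hm : m ≤ mX)
    {V : Set (X → E)} (hV : ∀ f ∈ V, Measurable[m] f ∧ MemLp f 2 μ) :
    IsClosedSquareIntegrable μ m (closedDecomposableHull μ m V) where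
  measurable _ hf := hf.1
  memLp _ hf := hf.2.1
  mem_of_approx f hfm hfL happ := by
    refine ⟨hfm, hfL, fun ε hε => ?_⟩
    obtain ⟨g, hg, hgε⟩ := happ (ε / 2) (ENNReal.half_pos hε.ne')
    obtain ⟨h, hh, hhε⟩ := hg.2.2 (ε / 2) (ENNReal.half_pos hε.ne')
    refine ⟨h, hh, ?_⟩
    rw [← sub_add_sub_cancel f g h]
    calc _ ≤ eLpNorm (f - g) 2 μ + eLpNorm (g - h) 2 μ :=
          eLpNorm_add_le (hfL.sub hg.2.1).1
            (hg.2.1.sub (decomposableHull_memLp hm hV h hh).2).1 one_le_two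
      _ < ε / 2 + ε / 2 := ENNReal.add_lt_add hgε hhε
      _ = ε := ENNReal.add_halves ε

end Representation

/-! ### Measurability and integrability of time integrals -/

section TimeIntegral

variable {S Ω E : Type*} {mS : MeasurableSpace S} {m mΩ : MeasurableSpace Ω}

/-- Cauchy–Schwarz against the constant one. -/
theorem sq_lintegral_le_measure_univ_mul {ν : Measure S} {f : S → ℝ≥0∞} (hf : AEMeasurable f ν) :
    (∫⁻ s, f s ∂ν) ^ 2 ≤ ν univ * ∫⁻ s, f s ^ 2 ∂ν := by
  have h := ENNReal.lintegral_mul_le_Lp_mul_Lq ν Real.HolderConjugate.two_two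
    (aemeasurable_const (b := (1 : ℝ≥0∞))) hf
  simp only [Pi.mul_apply, one_mul, lintegral_const, ENNReal.rpow_two] at h
  have h2 := pow_le_pow_left' h 2
  rw [mul_pow] at h2
  simpa only [← ENNReal.rpow_two, ← ENNReal.rpow_mul, one_div, inv_mul_cancel₀ (two_ne_zero' ℝ),
    ENNReal.rpow_one, one_pow, one_mul] using h2

theorem measurable_of_ae_eq_of_null {X β : Type*} {m mX : MeasurableSpace X} {mβ : MeasurableSpace β}
    {P : Measure X} (hnull : ∀ A : Set X, P A = 0 → MeasurableSet[m] A) {f g : X → β}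
    (hg : Measurable[m] g) (h : f =ᵐ[P] g) : Measurable[m] f := by
  intro B hB
  have hN : P {x | f x ≠ g x} = 0 := h
  have heq : f ⁻¹' B = (g ⁻¹' B ∩ {x | f x ≠ g x}ᶜ) ∪ (f ⁻¹' B ∩ {x | f x ≠ g x}) := by
    ext x
    by_cases hx : f x = g x <;> simp [hx]
  rw [heq]
  exact ((hg hB).inter (hnull _ hN).compl).union
    (hnull _ (measure_mono_null inter_subset_right hN))

variable [NormedAddCommGroup E] [InnerProductSpace ℝ E] [CompleteSpace E]
  {ν : Measure S} [IsFiniteMeasure ν] {P : Measure Ω} [IsFiniteMeasure P]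

omit [CompleteSpace E] in
theorem memLp_two_integral_left {φ : S → Ω → E}
    (hφ : MemLp (fun p : S × Ω => φ p.1 p.2) 2 (ν.prod P)) :
    MemLp (fun ω => ∫ s, φ s ω ∂ν) 2 P := by
  have hmeas : AEMeasurable (fun p : S × Ω => ‖φ p.1 p.2‖ₑ ^ 2) (ν.prod P) :=
    hφ.1.enorm.pow_const 2
  refine ⟨hφ.1.prod_swap.integral_prod_right', ?_⟩
  have hsq : ∫⁻ ω, ‖∫ s, φ s ω ∂ν‖ₑ ^ 2 ∂P < ∞ := by
    have hsl : ∀ᵐ ω ∂P, AEStronglyMeasurable (fun s => φ s ω) ν :=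
      hφ.1.prod_swap.prodMk_left
    calc ∫⁻ ω, ‖∫ s, φ s ω ∂ν‖ₑ ^ 2 ∂P ≤ ∫⁻ ω, ν univ * ∫⁻ s, ‖φ s ω‖ₑ ^ 2 ∂ν ∂P := by
          refine lintegral_mono_ae ?_
          filter_upwards [hsl] with ω hω
          exact (pow_le_pow_left' (enorm_integral_le_lintegral_enorm _) 2).trans
            (sq_lintegral_le_measure_univ_mul hω.enorm)
      _ = ν univ * ∫⁻ p, ‖φ p.1 p.2‖ₑ ^ 2 ∂(ν.prod P) := by
          rw [lintegral_const_mul' _ _ (measure_ne_top ν univ), lintegral_prod_symm _ hmeas]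
      _ < ∞ := by
          rw [← eLpNorm_two_pow_two]
          exact ENNReal.mul_lt_top (measure_lt_top ν univ) (ENNReal.pow_lt_top hφ.2)
  rw [← eLpNorm_two_pow_two] at hsq
  exact (ENNReal.pow_lt_top_iff.1 hsq).resolve_right two_ne_zero

/-- The time integral of a jointly measurable square integrable process all of whose sections are
`m`-measurable is `m`-measurable up to a null set (no progressive measurability is needed). -/
theorem aestronglyMeasurable_integral_left (hm : m ≤ mΩ) {φ : S → Ω → E}
    (hφ : MemLp (fun p : S × Ω => φ p.1 p.2) 2 (ν.prod P))
    (hφm : ∀ᵐ s ∂ν, AEStronglyMeasurable[m] (φ s) P) :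
    AEStronglyMeasurable[m] (fun ω => ∫ s, φ s ω ∂ν) P := by
  have hX := memLp_two_integral_left hφ
  set X : Lp E 2 P := hX.toLp with hXdef
  set C : Lp E 2 P := (condExpL2 E ℝ hm X : Lp E 2 P) with hC
  have hCm : AEStronglyMeasurable[m] C P := lpMeas.aestronglyMeasurable _
  -- `Y` is the part of the integral orthogonal to the `m`-measurable functions. Almost every slice
  -- `φ s` is `m`-measurable, hence orthogonal to `Y`; by Fubini so is their integral `X`. Thus `Y`
  -- is orthogonal to `X - C`, which is `Y` itself.
  set Y : Lp E 2 P := X - C with hY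
  have horth : ∀ Z : Lp E 2 P, AEStronglyMeasurable[m] Z P → inner ℝ Y Z = 0 := by
    intro Z hZ
    rw [hY, inner_sub_left, hC, inner_condExpL2_eq_inner_fun hm X Z hZ, sub_self]
  have hYprod : MemLp (fun p : S × Ω => Y p.2) 2 (ν.prod P) := (Lp.memLp Y).comp_snd ν
  have hint : Integrable (fun p : S × Ω => inner ℝ (Y p.2) (φ p.1 p.2)) (ν.prod P) :=
    (L2.integrable_inner (𝕜 := ℝ) hYprod.toLp hφ.toLp).congr <| by
      filter_upwards [hYprod.coeFn_toLp, hφ.coeFn_toLp] with p h1 h2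
      rw [h1, h2]
  have hφint : Integrable (fun p : S × Ω => φ p.1 p.2) (ν.prod P) := hφ.integrable one_le_two
  have hslice : ∀ᵐ s ∂ν, ∫ ω, inner ℝ (Y ω) (φ s ω) ∂P = 0 := by
    have hL : ∀ᵐ s ∂ν, MemLp (φ s) 2 P := by
      have h1 : ∫⁻ s, ∫⁻ ω, ‖φ s ω‖ₑ ^ 2 ∂P ∂ν ≠ ∞ := by
        rw [← lintegral_prod (fun p : S × Ω => ‖φ p.1 p.2‖ₑ ^ 2) (hφ.1.enorm.pow_const 2),
          ← eLpNorm_two_pow_two]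
        exact (ENNReal.pow_lt_top hφ.2).ne
      filter_upwards [hφ.1.prodMk_left,
        ae_lt_top' (hφ.1.enorm.pow_const 2).lintegral_prod_right' h1] with s hs hs'
      rw [← eLpNorm_two_pow_two] at hs'
      exact ⟨hs, (ENNReal.pow_lt_top_iff.1 hs').resolve_right two_ne_zero⟩
    filter_upwards [hL, hφm] with s hs hsm
    have h := horth hs.toLp (hsm.congr hs.coeFn_toLp.symm)
    rw [L2.inner_def] at h
    rw [← h]
    refine integral_congr_ae ?_
    filter_upwards [hs.coeFn_toLp] with ω hω
    rw [hω]
  have hYX : inner ℝ Y X = 0 := by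
    rw [L2.inner_def]
    calc ∫ ω, inner ℝ (Y ω) (X ω) ∂P = ∫ ω, ∫ s, inner ℝ (Y ω) (φ s ω) ∂ν ∂P := by
          refine integral_congr_ae ?_
          filter_upwards [hX.coeFn_toLp, hφint.prod_left_ae] with ω hω hi
          rw [hXdef, hω, integral_inner hi]
      _ = ∫ s, ∫ ω, inner ℝ (Y ω) (φ s ω) ∂P ∂ν := (integral_integral_swap hint).symm
      _ = 0 := by rw [integral_congr_ae hslice, integral_zero]
  have hY0 : Y = 0 := by
    rw [← inner_self_eq_zero (𝕜 := ℝ)]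
    nth_rewrite 2 [hY]
    rw [inner_sub_right, hYX, horth C hCm, sub_zero]
  have hXC : X = C := sub_eq_zero.1 hY0
  refine hCm.congr ?_
  rw [← hXC]
  exact hX.coeFn_toLp

end TimeIntegral

/-! ### Nonanticipative processes as measurable functions -/

section Nonanticipative

variable {Ω : Type*} {mΩ : MeasurableSpace Ω} {T : ℝ} {d : ℕ}

/-- The σ-algebra of jointly measurable sets with adapted sections. -/
abbrev nonanticipativeSigma (ℱ : Filtration (Icc (0 : ℝ) T) mΩ) :
    MeasurableSpace (Icc (0 : ℝ) T × Ω) :=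
  Prod.instMeasurableSpace ⊓ ⨅ s, MeasurableSpace.map (Prod.mk s) (ℱ s)

theorem measurableSet_nonanticipativeSigma {ℱ : Filtration (Icc (0 : ℝ) T) mΩ}
    {A : Set (Icc (0 : ℝ) T × Ω)} : MeasurableSet[nonanticipativeSigma ℱ] A ↔
      MeasurableSet A ∧ ∀ s, MeasurableSet[ℱ s] (Prod.mk s ⁻¹' A) := by
  rw [nonanticipativeSigma, MeasurableSpace.measurableSet_inf, MeasurableSpace.measurableSet_iInf]
  rfl

theorem nonanticipativeSigma_le (ℱ : Filtration (Icc (0 : ℝ) T) mΩ) :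
    nonanticipativeSigma ℱ ≤ Prod.instMeasurableSpace := inf_le_left

/-- With a single σ-algebra on the product, the general selection and gluing results apply to
processes directly. -/
theorem nonanticipative_iff {ℱ : Filtration (Icc (0 : ℝ) T) mΩ}
    {φ : Icc (0 : ℝ) T → Ω → EuclideanSpace ℝ (Fin d)} :
    Nonanticipative ℱ φ ↔
      Measurable[nonanticipativeSigma ℱ] fun p : Icc (0 : ℝ) T × Ω => φ p.1 p.2 := by
  refine ⟨fun h B hB => measurableSet_nonanticipativeSigma.2 ⟨h.1 hB, fun s => h.2 s hB⟩,
    fun h => ⟨fun B hB => (measurableSet_nonanticipativeSigma.1 (h hB)).1,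
      fun s B hB => (measurableSet_nonanticipativeSigma.1 (h hB)).2 s⟩⟩

theorem NonanticipativeSet.measurableMap {ℱ : Filtration (Icc (0 : ℝ) T) mΩ}
    {Φ : Icc (0 : ℝ) T → Ω → Set (EuclideanSpace ℝ (Fin d))} (h : NonanticipativeSet ℱ Φ) :
    MeasurableMap (nonanticipativeSigma ℱ) fun p : Icc (0 : ℝ) T × Ω => Φ p.1 p.2 :=
  fun C hC => measurableSet_nonanticipativeSigma.2 ⟨h.1 C hC, fun s => h.2 s C hC⟩

theorem timeMeasure_apply (T : ℝ) {A : Set (Icc (0 : ℝ) T)} :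
    timeMeasure T A = volume (Subtype.val '' A) :=
  comap_subtype_coe_apply measurableSet_Icc _ A

instance isFiniteMeasure_timeMeasure (T : ℝ) : IsFiniteMeasure (timeMeasure T) := by
  refine ⟨?_⟩
  rw [timeMeasure_apply, image_univ, Subtype.range_coe]
  exact measure_Icc_lt_top

theorem timeMeasure_Ioc (t₀ t : Icc (0 : ℝ) T) :
    timeMeasure T (Ioc t₀ t) = ENNReal.ofReal ((t : ℝ) - t₀) := by
  have h : Subtype.val '' Ioc t₀ t = Ioc (t₀ : ℝ) t := by
    ext x
    constructor
    · rintro ⟨y, hy, rfl⟩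
      exact hy
    · exact fun hx => ⟨⟨x, t₀.2.1.trans hx.1.le, hx.2.trans t.2.2⟩, hx, rfl⟩
  rw [timeMeasure_apply, h, Real.volume_Ioc]

end Nonanticipative

/-! ### Comparison of the two integrals -/

section Comparison

variable {Ω : Type*} {mΩ : MeasurableSpace Ω} {T : ℝ} {d : ℕ} {P : Measure Ω}
  [IsProbabilityMeasure P] {ℱ : Filtration (Icc (0 : ℝ) T) mΩ}
  {F F' Φ : Icc (0 : ℝ) T → Ω → Set (EuclideanSpace ℝ (Fin d))} {t₀ t : Icc (0 : ℝ) T}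

theorem MemLp.restrict_timeMeasure {E : Type*} [NormedAddCommGroup E]
    {φ : Icc (0 : ℝ) T × Ω → E} (h : MemLp φ 2 ((timeMeasure T).prod P))
    (A : Set (Icc (0 : ℝ) T)) : MemLp φ 2 (((timeMeasure T).restrict A).prod P) := by
  have h2 := h.restrict (A ×ˢ (univ : Set Ω))
  rwa [← Measure.prod_restrict, Measure.restrict_univ] at h2

/-- Only times up to `t` enter, so the slices are `ℱ t`-measurable; the integral is then measurable
up to a null set, and the null sets belong to `ℱ t`. -/
theorem selectorIntegrals_memLp
    (hnull : ∀ (s : Icc (0 : ℝ) T) (A : Set Ω), P A = 0 → MeasurableSet[ℱ s] A) :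
    ∀ f ∈ selectorIntegrals P ℱ Φ t₀ t, Measurable[ℱ t] f ∧ MemLp f 2 P := by
  rintro _ ⟨φ, ⟨hφ, hφL, -⟩, rfl⟩
  have hL := MemLp.restrict_timeMeasure hφL (Ioc t₀ t)
  refine ⟨?_, memLp_two_integral_left hL⟩
  have hae : AEStronglyMeasurable[ℱ t] (fun ω => ∫ s in Ioc t₀ t, φ s ω ∂(timeMeasure T)) P := by
    refine aestronglyMeasurable_integral_left (ℱ.le t) hL ?_
    filter_upwards [ae_restrict_mem measurableSet_Ioc] with s hs
    have hm : Measurable[ℱ t] (φ s) := (hφ.2 s).mono (ℱ.mono hs.2) le_rfl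
    exact hm.stronglyMeasurable.aestronglyMeasurable
  obtain ⟨g, hg, hfg⟩ := hae
  exact measurable_of_ae_eq_of_null (hnull t) hg.measurable hfg

theorem SquareIntegrableConvex.exists_isLebesgueIntegral
    (hnull : ∀ (s : Icc (0 : ℝ) T) (A : Set Ω), P A = 0 → MeasurableSet[ℱ s] A)
    (hF : SquareIntegrableConvex P ℱ F) : ∃ I, IsLebesgueIntegral P ℱ F t₀ t I := by
  have hV := selectorIntegrals_memLp (Φ := F) (t₀ := t₀) (t := t) hnull
  have hne : (selectorIntegrals P ℱ F t₀ t).Nonempty := hF.selectors_nonempty.image _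
  obtain ⟨I, h1, h2, h3, h4⟩ :=
    (isClosedSquareIntegrable_closedDecomposableHull (ℱ.le t) hV).exists_squareSelectors_eq
      (ℱ.le t) (isDecomposable_closedDecomposableHull (ℱ.le t) hV)
      (hne.mono ((subset_decomposableHull _).trans
        (decomposableHull_subset_closedDecomposableHull (ℱ.le t) hV)))
  exact ⟨I, h1, h2, h3, h4⟩

omit [IsProbabilityMeasure P] in
/-- Any square integrable selector is approximated optimally, in a monotone way, by square
integrable selectors of `F'`. -/
theorem SquareIntegrableConvex.exists_approximating_selectors
    (hF' : SquareIntegrableConvex P ℱ F') {φ : Icc (0 : ℝ) T → Ω → EuclideanSpace ℝ (Fin d)}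
    (hφ : Nonanticipative ℱ φ)
    (hφL : MemLp (fun p : Icc (0 : ℝ) T × Ω => φ p.1 p.2) 2 ((timeMeasure T).prod P)) :
    ∃ g : ℕ → Icc (0 : ℝ) T → Ω → EuclideanSpace ℝ (Fin d),
      (∀ n, g n ∈ nonanticipativeSelectors P ℱ F') ∧
      (∀ s ω, Antitone fun n => edist (φ s ω) (g n s ω)) ∧
      ∀ s ω, ⨅ n, edist (φ s ω) (g n s ω) ≤ Metric.infEDist (φ s ω) (F' s ω) := by
  obtain ⟨ψ, hψ, hψL, hψF⟩ := hF'.selectors_nonempty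
  obtain ⟨c, hcm, hcF, hcd⟩ := hF'.nonanticipative.measurableMap.exists_castaing
    (fun p => hF'.nonempty p.1 p.2) (fun p => hF'.isClosed p.1 p.2)
  -- No integrability is imposed here, since Castaing selectors need not be square integrable.
  set W : Set (Icc (0 : ℝ) T × Ω → EuclideanSpace ℝ (Fin d)) :=
    {f | Measurable[nonanticipativeSigma ℱ] f ∧
      ∀ᵐ p ∂((timeMeasure T).prod P), f p ∈ F' p.1 p.2} with hW
  have hdec : IsDecomposable (nonanticipativeSigma ℱ) W := by
    classical
    rintro f ⟨hfm, hf⟩ g ⟨hgm, hg⟩ A hA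
    refine ⟨(hfm.indicator hA).add (hgm.indicator hA.compl), ?_⟩
    filter_upwards [hf, hg] with p h1 h2
    rw [indicator_add_indicator_compl_apply]
    split_ifs
    exacts [h1, h2]
  -- Starting from the square integrable `ψ` gives |φ - gₙ| ≤ |φ - ψ|, which restores square
  -- integrability of every glued selector.
  let f : ℕ → Icc (0 : ℝ) T × Ω → EuclideanSpace ℝ (Fin d) := fun n =>
    Nat.casesOn n (fun p => ψ p.1 p.2) c
  have hf : ∀ n, f n ∈ W := by
    rintro (_ | n)
    · exact ⟨nonanticipative_iff.1 hψ, hψF⟩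
    · exact ⟨hcm n, ae_of_all _ (hcF n)⟩
  obtain ⟨g, hgW, hanti, hg0, hgf⟩ := exists_antitone_edist hdec (fun f hf => hf.1)
    (nonanticipative_iff.1 hφ) hf
  refine ⟨fun n s ω => g n (s, ω), fun n => ⟨nonanticipative_iff.2 (hgW n).1, ?_, (hgW n).2⟩,
    fun s ω => hanti (s, ω), fun s ω => ?_⟩
  · have hgm : Measurable (g n) := (hgW n).1.mono (nonanticipativeSigma_le ℱ) le_rfl
    have hd : MemLp (fun p => φ p.1 p.2 - g n p) 2 ((timeMeasure T).prod P) := by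
      refine (hφL.sub hψL).mono (hφ.1.sub hgm).aestronglyMeasurable (ae_of_all _ fun p => ?_)
      have h := hanti p (Nat.zero_le n)
      simp only [hg0, edist_dist] at h
      rw [ENNReal.ofReal_le_ofReal_iff dist_nonneg, dist_eq_norm, dist_eq_norm] at h
      exact h
    have heq : g n = (fun p => φ p.1 p.2) - fun p => φ p.1 p.2 - g n p := by
      ext1 p
      simp
    change MemLp (g n) 2 _
    rw [heq]
    exact hφL.sub hd
  · refine le_trans (le_iInf fun n => ?_) (iInf_edist_le_infEDist (hcd (s, ω)))
    exact (iInf_le _ (n + 1)).trans (hgf (n + 1) (s, ω))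

theorem ae_integrable_slice {φ : Icc (0 : ℝ) T → Ω → EuclideanSpace ℝ (Fin d)}
    (hφL : MemLp (fun p : Icc (0 : ℝ) T × Ω => φ p.1 p.2) 2 ((timeMeasure T).prod P))
    (t₀ t : Icc (0 : ℝ) T) :
    ∀ᵐ ω ∂P, Integrable (fun s => φ s ω) ((timeMeasure T).restrict (Ioc t₀ t)) :=
  ((MemLp.restrict_timeMeasure hφL (Ioc t₀ t)).integrable one_le_two).prod_left_ae

theorem IsLebesgueIntegral.ae_mem_of_mem_decomposableHull
    (hnull : ∀ (s : Icc (0 : ℝ) T) (A : Set Ω), P A = 0 → MeasurableSet[ℱ s] A)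
    {I : Ω → Set (EuclideanSpace ℝ (Fin d))} (hI : IsLebesgueIntegral P ℱ F t₀ t I)
    {f : Ω → EuclideanSpace ℝ (Fin d)}
    (hf : f ∈ decomposableHull (ℱ t) (selectorIntegrals P ℱ F t₀ t)) : ∀ᵐ ω ∂P, f ω ∈ I ω := by
  have h := decomposableHull_subset_closedDecomposableHull (ℱ.le t)
    (selectorIntegrals_memLp hnull) hf
  rw [← hI.selectors_eq] at h
  exact h.2.2

/-- Integrals of selectors of `F` stay close to the set-valued integral of `F'`. -/
theorem IsLebesgueIntegral.ae_sq_infEDist_le_of_mem_selectorIntegrals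
    (hnull : ∀ (s : Icc (0 : ℝ) T) (A : Set Ω), P A = 0 → MeasurableSet[ℱ s] A)
    (hF' : SquareIntegrableConvex P ℱ F') {I' : Ω → Set (EuclideanSpace ℝ (Fin d))}
    (hI' : IsLebesgueIntegral P ℱ F' t₀ t I') {f : Ω → EuclideanSpace ℝ (Fin d)}
    (hf : f ∈ selectorIntegrals P ℱ F t₀ t) :
    ∀ᵐ ω ∂P, Metric.infEDist (f ω) (I' ω) ^ 2 ≤ ENNReal.ofReal ((t : ℝ) - t₀) *
      ∫⁻ s in Ioc t₀ t, Metric.hausdorffEDist (F s ω) (F' s ω) ^ 2 ∂(timeMeasure T) := by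
  obtain ⟨φ, ⟨hφ, hφL, hφF⟩, rfl⟩ := hf
  obtain ⟨g, hg, hanti, hinf⟩ := hF'.exists_approximating_selectors hφ hφL
  have hmem : ∀ᵐ ω ∂P, ∀ n, ∫ s in Ioc t₀ t, g n s ω ∂(timeMeasure T) ∈ I' ω :=
    ae_all_iff.2 fun n => hI'.ae_mem_of_mem_decomposableHull hnull
      (subset_decomposableHull _ ⟨g n, hg n, rfl⟩)
  have hgint : ∀ᵐ ω ∂P, ∀ n,
      Integrable (fun s => g n s ω) ((timeMeasure T).restrict (Ioc t₀ t)) :=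
    ae_all_iff.2 fun n => ae_integrable_slice (hg n).2.1 t₀ t
  have hφF' : ∀ᵐ ω ∂P, ∀ᵐ s ∂(timeMeasure T), φ s ω ∈ F s ω :=
    Measure.ae_ae_of_ae_prod (Measure.measurePreserving_swap.quasiMeasurePreserving.ae hφF)
  filter_upwards [hmem, hgint, ae_integrable_slice hφL t₀ t, hφF'] with ω hm hgi hφi hφF
  set ν := (timeMeasure T).restrict (Ioc t₀ t) with hν
  have hmeas : ∀ n, Measurable fun s => edist (φ s ω) (g n s ω) := fun n =>
    (hφ.1.comp measurable_prodMk_right).edist ((hg n).1.1.comp measurable_prodMk_right)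
  have hle : ∀ n, Metric.infEDist (∫ s, φ s ω ∂ν) (I' ω) ≤ ∫⁻ s, edist (φ s ω) (g n s ω) ∂ν := by
    intro n
    refine (Metric.infEDist_le_edist_of_mem (hm n)).trans ?_
    rw [edist_eq_enorm_sub, ← integral_sub hφi (hgi n)]
    simp only [edist_eq_enorm_sub]
    exact enorm_integral_le_lintegral_enorm _
  have hfin : ∫⁻ s, edist (φ s ω) (g 0 s ω) ∂ν ≠ ∞ := by
    simp only [edist_eq_enorm_sub]
    exact (hφi.sub (hgi 0)).2.ne
  have hle' := le_iInf hle
  rw [← lintegral_iInf hmeas (fun i j hij s => hanti s ω hij) hfin] at hle'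
  have huniv : ν univ = ENNReal.ofReal ((t : ℝ) - t₀) := by
    rw [hν, Measure.restrict_apply_univ, timeMeasure_Ioc]
  rw [← huniv]
  -- Cauchy–Schwarz is applied to the measurable infimum of the distances; the Hausdorff distance
  -- enters only afterwards as an upper bound, so its measurability is not needed.
  refine (pow_le_pow_left' hle' 2).trans ((sq_lintegral_le_measure_univ_mul
    (Measurable.iInf hmeas).aemeasurable).trans (mul_le_mul_right ?_ _))
  refine lintegral_mono_ae ?_
  filter_upwards [ae_restrict_of_ae hφF] with s hs
  exact pow_le_pow_left' ((hinf s ω).trans (Metric.infEDist_le_hausdorffEDist_of_mem hs)) 2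

/-- A bound on the distance to `I` that holds on `V` holds on its closed decomposable hull. -/
theorem ae_sq_infEDist_le_of_mem_closedDecomposableHull {X E : Type*} [NormedAddCommGroup E]
    [SecondCountableTopology E] [MeasurableSpace E] [BorelSpace E] {m mX : MeasurableSpace X}
    {μ : Measure X} (hm : m ≤ mX) {V : Set (X → E)} {I : X → Set E} {R : X → ℝ≥0∞}
    (hVm : ∀ f ∈ V, Measurable[m] f ∧ MemLp f 2 μ)
    (hV : ∀ f ∈ V, ∀ᵐ x ∂μ, Metric.infEDist (f x) (I x) ^ 2 ≤ R x) {f : X → E}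
    (hf : f ∈ closedDecomposableHull μ m V) :
    ∀ᵐ x ∂μ, Metric.infEDist (f x) (I x) ^ 2 ≤ R x := by
  classical
  have hhull : decomposableHull m V ⊆
      {f | ∀ᵐ x ∂μ, Metric.infEDist (f x) (I x) ^ 2 ≤ R x} := by
    refine decomposableHull_subset (fun f hf g hg A _ => ?_) hV
    simp only [mem_ofPred_eq] at hf hg ⊢
    filter_upwards [hf, hg] with x h1 h2
    rw [indicator_add_indicator_compl_apply]
    split_ifs
    exacts [h1, h2]
  choose g hg hgf using fun n : ℕ => hf.2.2 ((n : ℝ≥0∞)⁻¹) (by simp)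
  -- L² convergence gives a.e. convergence along a subsequence, and the distance to `I x` is
  -- continuous.
  have hlim : TendstoInMeasure μ g atTop f := by
    refine tendstoInMeasure_of_tendsto_eLpNorm two_ne_zero
      (fun n => (decomposableHull_memLp hm hVm _ (hg n)).2.1) hf.2.1.1 ?_
    refine tendsto_of_tendsto_of_tendsto_of_le_of_le tendsto_const_nhds
      ENNReal.tendsto_inv_nat_nhds_zero (fun _ => zero_le) fun n => ?_
    dsimp only
    rw [eLpNorm_sub_comm]
    exact (hgf n).le
  obtain ⟨ns, -, hns⟩ := hlim.exists_seq_tendsto_ae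
  have hall : ∀ᵐ x ∂μ, ∀ n, Metric.infEDist (g n x) (I x) ^ 2 ≤ R x :=
    ae_all_iff.2 fun n => hhull (hg n)
  filter_upwards [hall, hns] with x h1 h2
  exact le_of_tendsto (ENNReal.Tendsto.pow (n := 2)
    ((Metric.continuous_infEDist.tendsto (f x)).comp h2)) (Eventually.of_forall fun i => h1 (ns i))

/-- If all square integrable selectors of `I` are close to `I'`, so are all points of `I`. -/
theorem ae_forall_mem_sq_infEDist_le {X E : Type*} [NormedAddCommGroup E]
    [ProperSpace E] [MeasurableSpace E] [BorelSpace E] {m mX : MeasurableSpace X}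
    {μ : Measure X} [IsFiniteMeasure μ] (hm : m ≤ mX) {I I' : X → Set E} {R : X → ℝ≥0∞}
    (hIm : MeasurableMap m I) (hne : ∀ x, (I x).Nonempty) (hcl : ∀ x, IsClosed (I x))
    (hS : (squareSelectors μ m I).Nonempty)
    (h : ∀ f ∈ squareSelectors μ m I, ∀ᵐ x ∂μ, Metric.infEDist (f x) (I' x) ^ 2 ≤ R x) :
    ∀ᵐ x ∂μ, ∀ y ∈ I x, Metric.infEDist y (I' x) ^ 2 ≤ R x := by
  classical
  obtain ⟨f, hfm, hfL, hfI⟩ := hS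
  obtain ⟨c, hcm, hcI, hcd⟩ := hIm.exists_castaing hne hcl
  -- `c n` is kept where it is bounded by `k` and replaced by the square integrable `f` elsewhere.
  -- At each point some `k` recovers the value of `c n`.
  let A : ℕ → ℕ → Set X := fun n k => {x | ‖c n x‖ ≤ k}
  have hA : ∀ n k, MeasurableSet[m] (A n k) := fun n k =>
    measurable_norm.comp (hcm n) measurableSet_Iic
  have hsel : ∀ n k, (A n k).indicator (c n) + (A n k)ᶜ.indicator f ∈ squareSelectors μ m I := by
    intro n k
    refine ⟨((hcm n).indicator (hA n k)).add (hfm.indicator (hA n k).compl), ?_, ?_⟩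
    · refine MemLp.add ?_ (hfL.indicator (hm _ (hA n k)).compl)
      refine MemLp.of_bound
        (((hcm n).mono hm le_rfl).indicator (hm _ (hA n k))).aestronglyMeasurable k
        (ae_of_all _ fun x => ?_)
      by_cases hx : x ∈ A n k
      · rw [indicator_of_mem hx]
        exact hx
      · simp [indicator_of_notMem hx]
    · filter_upwards [hfI] with x hx
      rw [indicator_add_indicator_compl_apply]
      split_ifs
      exacts [hcI n x, hx]
  have hall : ∀ᵐ x ∂μ, ∀ n k, Metric.infEDist
      (((A n k).indicator (c n) + (A n k)ᶜ.indicator f) x) (I' x) ^ 2 ≤ R x :=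
    ae_all_iff.2 fun n => ae_all_iff.2 fun k => h _ (hsel n k)
  filter_upwards [hall] with x hx y hy
  have hclosed : IsClosed {y | Metric.infEDist y (I' x) ^ 2 ≤ R x} :=
    isClosed_le ((ENNReal.continuous_pow 2).comp Metric.continuous_infEDist) continuous_const
  refine closure_minimal ?_ hclosed (hcd x hy)
  rintro _ ⟨n, rfl⟩
  obtain ⟨k, hk⟩ := exists_nat_ge ‖c n x‖
  have := hx n k
  rwa [indicator_add_indicator_compl_apply, if_pos (show x ∈ A n k from hk)] at this

theorem IsLebesgueIntegral.ae_forall_mem_sq_infEDist_le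
    (hnull : ∀ (s : Icc (0 : ℝ) T) (A : Set Ω), P A = 0 → MeasurableSet[ℱ s] A)
    (hF : SquareIntegrableConvex P ℱ F) (hF' : SquareIntegrableConvex P ℱ F')
    {I I' : Ω → Set (EuclideanSpace ℝ (Fin d))} (hI : IsLebesgueIntegral P ℱ F t₀ t I)
    (hI' : IsLebesgueIntegral P ℱ F' t₀ t I') :
    ∀ᵐ ω ∂P, ∀ y ∈ I ω, Metric.infEDist y (I' ω) ^ 2 ≤ ENNReal.ofReal ((t : ℝ) - t₀) *
      ∫⁻ s in Ioc t₀ t, Metric.hausdorffEDist (F s ω) (F' s ω) ^ 2 ∂(timeMeasure T) := by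
  have hV := selectorIntegrals_memLp (Φ := F) (t₀ := t₀) (t := t) hnull
  refine SetValued.ae_forall_mem_sq_infEDist_le (ℱ.le t) hI.measurable hI.nonempty hI.isClosed
    ?_ fun f hf => ?_
  · rw [hI.selectors_eq]
    exact (hF.selectors_nonempty.image _).mono ((subset_decomposableHull _).trans
        (decomposableHull_subset_closedDecomposableHull (ℱ.le t) hV))
  · rw [hI.selectors_eq] at hf
    exact ae_sq_infEDist_le_of_mem_closedDecomposableHull (ℱ.le t) hV
      (fun f hf => hI'.ae_sq_infEDist_le_of_mem_selectorIntegrals hnull hF' hf) hf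

end Comparison

theorem sq_hausdorffEDist_le {E : Type*} [PseudoEMetricSpace E] {A B : Set E} {R : ℝ≥0∞}
    (hA : ∀ x ∈ A, Metric.infEDist x B ^ 2 ≤ R) (hB : ∀ x ∈ B, Metric.infEDist x A ^ 2 ≤ R) :
    Metric.hausdorffEDist A B ^ 2 ≤ R := by
  have key : ∀ a : ℝ≥0∞, a ^ 2 ≤ R ↔ a ≤ R ^ (2⁻¹ : ℝ) := fun a => by
    rw [ENNReal.le_rpow_inv_iff two_pos, ENNReal.rpow_two]
  simp only [key] at *
  exact Metric.hausdorffEDist_le_of_infEDist hA hB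

end SetValued

theorem theorem4p3 {Ω : Type*} [mΩ : MeasurableSpace Ω] (P : Measure Ω) [IsProbabilityMeasure P]
    {d : ℕ} {T : ℝ} (hT : 0 < T)
    (ℱ : Filtration (Icc (0 : ℝ) T) mΩ)
    (hnull : ∀ (s : Icc (0 : ℝ) T) (A : Set Ω), P A = 0 → MeasurableSet[ℱ s] A)
    (F F' : Icc (0 : ℝ) T → Ω → Set (EuclideanSpace ℝ (Fin d)))
    (hF : SetValued.SquareIntegrableConvex P ℱ F)
    (hF' : SetValued.SquareIntegrableConvex P ℱ F')
    (hh : ∫⁻ ω, (∫⁻ s, Metric.hausdorffEDist (F s ω) (F' s ω) ^ 2 ∂(SetValued.timeMeasure T)) ∂P < ∞)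
    (t₀ t : Icc (0 : ℝ) T) (ht : t₀ < t) :
    (∃ I, SetValued.IsLebesgueIntegral P ℱ F t₀ t I) ∧
    (∃ I', SetValued.IsLebesgueIntegral P ℱ F' t₀ t I') ∧
    ∀ I I', SetValued.IsLebesgueIntegral P ℱ F t₀ t I →
      SetValued.IsLebesgueIntegral P ℱ F' t₀ t I' →
      ∀ᵐ ω ∂P, Metric.hausdorffEDist (I ω) (I' ω) ^ 2 ≤
        ENNReal.ofReal ((t : ℝ) - (t₀ : ℝ)) *
          ∫⁻ s in Ioc t₀ t, Metric.hausdorffEDist (F s ω) (F' s ω) ^ 2 ∂(SetValued.timeMeasure T) := by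
  refine ⟨hF.exists_isLebesgueIntegral hnull, hF'.exists_isLebesgueIntegral hnull,
    fun I I' hI hI' => ?_⟩
  filter_upwards [hI.ae_forall_mem_sq_infEDist_le hnull hF hF' hI',
    hI'.ae_forall_mem_sq_infEDist_le hnull hF' hF hI] with ω h1 h2
  refine SetValued.sq_hausdorffEDist_le h1 ?_
  simpa only [Metric.hausdorffEDist_comm] using h2
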